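/- **Proposition 3.2.** Let $\mathbb K$ be an algebraically closed field of characteristic zero, $A$ a finite-dimensional $\mathbb K$-vector space, $x\in\mathrm{End}(A)$ nilpotent, $m\ge 0$ the least integer with $x^m=0$, and $l_i=\dim\ker x^i$. Let $P\subset GL(A)$ be the parabolic subgroup of the elements leaving every $\ker x^i$ invariant. Let $s\in P$ be a semisimple element whose centralizer $Z_{GL(A)}(s)$ is a Levi subgroup of $P$ and such that $sxs^{-1}=qx$ for some $q\in\mathbb K^*$. Let $k_1\le\dots\le k_n$ be integers in $\{0,\dots,\dim A\}$, and let $\mathcal A$ be the variety of partial flags $V_\bullet=(V_1\subset\dots\subset V_n\subset A)$ with $\dim V_j=k_j$. Let $\mathcal A_x^s\subset\mathcal A$ be the subvariety of the flags with $x(V_j)\subset V_j$ and $s(V_j)=V_j$ for all $j$. Let $\alpha=(\alpha_{i,j})_{1\le i\le m,\,1\le j\le n}$ be a matrix of integers such that 1. $0\le\alpha_{i,j}\le\alpha_{i',j'}$ whenever $i\le i'$, $j\le j'$, and $\alpha_{m,j}=k_j$ for all $j$; 2. $\alpha_{i',j'}-\alpha_{i'-1,j'}\le\alpha_{i,j}-\alpha_{i-1,j}\le\alpha_{1,j}$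 whenever $2\le i\le i'$, $j'\le j$; 3. $\alpha_{i,j}-\alpha_{i-1,j}\le l_i-l_{i-1}$ for $2\le i\le m$, and $\alpha_{1,j}\le l_1$, for all $j$; and set $\mathcal P_\alpha=\{V_\bullet\in\mathcal A:\dim (V_j\cap\ker x^i)=\alpha_{i,j}\ \forall i,j\}$. For $1\le i\le m$ let $A_i=x^{m-i}(\ker x^{m-i+1})$, and let $\kappa_{i,j}=\alpha_{m-i+1,j}-\alpha_{m-i,j}$ if $i\le m-1$ and $\kappa_{m,j}=\alpha_{1,j}$. Then $A_1\subset\dots\subset A_m$ with $\dim A_i=\dim\ker x^{m-i+1}-\dim\ker x^{m-i}$; moreover $0\le\kappa_{i,j}\le\dim A_i$ and $\kappa_{i,j}\le\kappa_{i',j'}$ whenever $i\le i'$, $j\le j'$. Let $\mathcal F_\kappa(A_\bullet)$ be the variety (a closed subvariety of a product of Grassmannians) of all families $(V_{i,j})_{1\le i\le m,\,1\le j\le n}$ of subspaces $V_{i,j}\subset A_i$ with $\dim V_{i,j}=\kappa_{i,j}$ and $V_{i,j}\subset V_{i',j'}$ whenever $i\le i'$, $j\le j'$. (a) $\mathcal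 A_x^s\cap\mathcal P_\alpha$ is open and closed in $\mathcal A_x^s$ (Zariski topology). (b) The map $$\mathcal A_x^s\cap\mathcal P_\alpha\to\mathcal F_\kappa(A_\bullet),\qquad (V_1,\dots,V_n)\mapsto\bigl(x^{m-i}(V_j\cap\ker x^{m-i+1})\bigr)_{1\le i\le m,\,1\le j\le n}$$ is well defined and is an isomorphism of algebraic varieties. -/

import Mathlib

namespace NilFlag

section Zariski

/-- The algebra of polynomial functions on a finite dimensional vector space `W`:
the algebra of functions generated by the linear forms. -/
def polyFun (K W : Type*) [Field K] [AddCommGroup W] [Module K W] : Subalgebra K (W → K) :=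
  Algebra.adjoin K (Set.range fun l : Module.Dual K W => (l : W → K))

/-- Families `(V_t)`, `t ∈ ι`, of subspaces of `A` (`ι` finite, `A` finite dimensional), i.e. the
points of the variety `∏_t ⨆_k Grass_k(A)`, the disjoint union over all dimension vectors `r`
of the products of Grassmannians `∏_t Grass_{r_t}(A)`. -/
def Fam (K A ι : Type*) [Field K] [AddCommGroup A] [Module K A] : Type _ :=
  ι → Submodule K A

variable {K A ι ι' : Type*} [Field K] [AddCommGroup A] [Module K A]

/-- The vector space of all families of tuples of vectors of `A`, the `t`-th tuple
having length `r t`. -/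
abbrev Tuples (A : Type*) {ι : Type*} (r : ι → ℕ) : Type _ := (t : ι) → Fin (r t) → A

/-- The frames with dimension vector `r`: the families of linearly independent tuples.
They form an open subset of `Tuples A r`. -/
def frames (K A : Type*) [Field K] [AddCommGroup A] [Module K A] {ι : Type*} (r : ι → ℕ) :
    Set (Tuples A r) :=
  {f | ∀ t, LinearIndependent K (f t)}

/-- The family of subspaces spanned by a frame. Restricted to `frames K A r`, this is the
quotient map of `∏_t Grass_{r_t}(A)` by `∏_t GL_{r_t}`, a principal bundle which is locally
trivial for the Zariski topology. -/
def spanFam (K : Type*) {A ι : Type*} [Field K] [AddCommGroup A] [Module K A] {r : ι → ℕ}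
    (f : Tuples A r) : Fam K A ι :=
  fun t => Submodule.span K (Set.range (f t))

/-- The Zariski topology on families of subspaces: a set is open if and only if, for each
dimension vector `r`, the set of the frames that span one of its elements is Zariski open in
the set of all frames, i.e. is a union of principal open sets `{g | Q g ≠ 0}`. -/
instance zariski : TopologicalSpace (Fam K A ι) where
  IsOpen U := ∀ r : ι → ℕ, ∀ f ∈ frames K A r, spanFam K f ∈ U →
    ∃ Q ∈ polyFun K (Tuples A r), Q f ≠ 0 ∧
      ∀ g ∈ frames K A r, Q g ≠ 0 → spanFam K g ∈ U
  isOpen_univ := fun _ _ _ _ => ⟨1, one_mem _, one_ne_zero, fun _ _ _ => trivial⟩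
  isOpen_inter := by
    intro U V hU hV r f hf hfUV
    obtain ⟨Q, hQ, hQf, hQU⟩ := hU r f hf hfUV.1
    obtain ⟨R, hR, hRf, hRV⟩ := hV r f hf hfUV.2
    refine ⟨Q * R, mul_mem hQ hR, mul_ne_zero hQf hRf, fun g hg h => ?_⟩
    exact ⟨hQU g hg (left_ne_zero_of_mul h), hRV g hg (right_ne_zero_of_mul h)⟩
  isOpen_sUnion := by
    intro S hS r f hf hfS
    obtain ⟨U, hUS, hfU⟩ := hfS
    obtain ⟨Q, hQ, hQf, hQU⟩ := hS U hUS r f hf hfU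
    exact ⟨Q, hQ, hQf, fun g hg h => ⟨U, hUS, hQU g hg h⟩⟩

/-- Regularity of the restriction to `U` of a function `φ` (only the values of `φ` on `U`
matter; `U` is an open subset of a subvariety): as a function of frames, `φ` is locally a
quotient of two polynomial functions. -/
def IsRegularOn (U : Set (Fam K A ι)) (φ : Fam K A ι → K) : Prop :=
  ∀ r : ι → ℕ, ∀ f ∈ frames K A r, spanFam K f ∈ U →
    ∃ P ∈ polyFun K (Tuples A r), ∃ Q ∈ polyFun K (Tuples A r), Q f ≠ 0 ∧
      ∀ g ∈ frames K A r, spanFam K g ∈ U → Q g ≠ 0 → φ (spanFam K g) = P g / Q g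

/-- `F` restricts to a morphism of algebraic varieties from `X` to `Y`: it maps `X` to `Y`, is
continuous on `X`, and pulls back regular functions on open subsets of `Y` to regular functions
on their preimages in `X`. -/
structure IsMorphismOn (X : Set (Fam K A ι)) (Y : Set (Fam K A ι'))
    (F : Fam K A ι → Fam K A ι') : Prop where
  mapsTo : Set.MapsTo F X Y
  continuousOn : ContinuousOn F X
  regular : ∀ U : Set (Fam K A ι'), IsOpen U → ∀ φ : Fam K A ι' → K,
    IsRegularOn (Y ∩ U) φ → IsRegularOn (X ∩ F ⁻¹' U) (φ ∘ F)

/-- `F` restricts to an isomorphism of algebraic varieties from `X` onto `Y`: it has a two-sided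
inverse, and both are morphisms. -/
def IsIsomorphismOn (X : Set (Fam K A ι)) (Y : Set (Fam K A ι'))
    (F : Fam K A ι → Fam K A ι') : Prop :=
  IsMorphismOn X Y F ∧ ∃ G : Fam K A ι' → Fam K A ι, IsMorphismOn Y X G ∧ Set.InvOn G F X Y

end Zariski

section Flags

variable {K A : Type*} [Field K] [AddCommGroup A] [Module K A]

/-- The variety of partial flags `V_1 ⊆ ... ⊆ V_n ⊆ A` with dimension vector `k`. -/
def partialFlags (K A : Type*) [Field K] [AddCommGroup A] [Module K A] {n : ℕ} (k : Fin n → ℕ) :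
    Set (Fam K A (Fin n)) :=
  {V | (∀ j, Module.finrank K (V j) = k j) ∧ ∀ j j', j ≤ j' → V j ≤ V j'}

/-- The variety of doubly indexed flags: `V_{i,j}` is a subspace of `B_i` of dimension `κ_{i,j}`,
and `V_{i,j} ⊆ V_{i',j'}` whenever `i ≤ i'` and `j ≤ j'`. -/
def doubleFlags {I J : Type*} [Preorder I] [Preorder J] (B : I → Submodule K A)
    (κ : I → J → ℤ) : Set (Fam K A (I × J)) :=
  {V | (∀ i j, V (i, j) ≤ B i ∧ (Module.finrank K (V (i, j)) : ℤ) = κ i j) ∧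
    ∀ i i' j j', i ≤ i' → j ≤ j' → V (i, j) ≤ V (i', j')}

/-- The parabolic subgroup of the elements of `GL(A)` that leave each `ker x^i` invariant. -/
def parabolic (x : Module.End K A) : Subgroup (LinearMap.GeneralLinearGroup K A) where
  carrier := {g | ∀ i : ℕ, ∀ v : A,
    (g : Module.End K A) v ∈ LinearMap.ker (x ^ i) ↔ v ∈ LinearMap.ker (x ^ i)}
  mul_mem' := by
    intro a b ha hb i v
    have h : ((a * b : LinearMap.GeneralLinearGroup K A) : Module.End K A) v
        = (a : Module.End K A) ((b : Module.End K A) v) := rfl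
    rw [h, ha, hb]
  one_mem' := fun _ _ => Iff.rfl
  inv_mem' := by
    intro a ha i v
    have h : (a : Module.End K A)
        (((a⁻¹ : LinearMap.GeneralLinearGroup K A) : Module.End K A) v) = v := by
      rw [← Module.End.mul_apply, Units.mul_inv, Module.End.one_apply]
    rw [← ha, h]

/-- The unipotent radical of the parabolic subgroup: its elements that act as the identity on
each quotient `ker x^(i+1) / ker x^i`. -/
def unipotentRadical (x : Module.End K A) : Subgroup (LinearMap.GeneralLinearGroup K A) where
  carrier := {g | g ∈ parabolic x ∧ ∀ i : ℕ, ∀ v ∈ LinearMap.ker (x ^ (i + 1)),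
    (g : Module.End K A) v - v ∈ LinearMap.ker (x ^ i)}
  mul_mem' := by
    rintro a b ⟨ha, ha'⟩ ⟨hb, hb'⟩
    refine ⟨mul_mem ha hb, fun i v hv => ?_⟩
    have h : ((a * b : LinearMap.GeneralLinearGroup K A) : Module.End K A) v - v
        = ((a : Module.End K A) ((b : Module.End K A) v) - (b : Module.End K A) v)
          + ((b : Module.End K A) v - v) := by
      rw [sub_add_sub_cancel]; rfl
    rw [h]
    exact add_mem (ha' i _ ((hb (i + 1) v).2 hv)) (hb' i v hv)
  one_mem' := by
    refine ⟨one_mem _, fun i v _ => ?_⟩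
    simp
  inv_mem' := by
    rintro a ⟨ha, ha'⟩
    refine ⟨inv_mem ha, fun i v hv => ?_⟩
    have h : (a : Module.End K A)
        (((a⁻¹ : LinearMap.GeneralLinearGroup K A) : Module.End K A) v) = v := by
      rw [← Module.End.mul_apply, Units.mul_inv, Module.End.one_apply]
    have h2 := ha' i _ ((inv_mem ha (i + 1) v).2 hv)
    rw [h] at h2
    rw [← neg_sub]
    exact neg_mem h2

/-- A closed subgroup `L` of `GL(A)` is a Levi subgroup of the parabolic subgroup `P` if `P` is the
semidirect product of `L` and the (normal) unipotent radical of `P`. This is only used for the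
centralizer of an element, which is always closed. -/
def IsLevi (x : Module.End K A) (L : Subgroup (LinearMap.GeneralLinearGroup K A)) : Prop :=
  L ⊓ unipotentRadical x = ⊥ ∧ L ⊔ unipotentRadical x = parabolic x

/-- The choice of `s`: a semisimple element of the parabolic subgroup whose centralizer in `GL(A)`
is a Levi subgroup of it, and such that `s x s⁻¹ = q x` for some nonzero `q`. -/
structure IsAdapted (x : Module.End K A) (s : LinearMap.GeneralLinearGroup K A) : Prop where
  semisimple : Module.End.IsSemisimple (s : Module.End K A)
  mem_parabolic : s ∈ parabolic x
  levi : IsLevi x (Subgroup.centralizer {s})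
  conj : ∃ q : K, q ≠ 0 ∧
    (s : Module.End K A) * x * ((s⁻¹ : LinearMap.GeneralLinearGroup K A) : Module.End K A) = q • x

/-- The variety of the `x`-stable partial flags fixed by `s`. -/
def fixedStableFlags (x : Module.End K A) (s : LinearMap.GeneralLinearGroup K A) {n : ℕ}
    (k : Fin n → ℕ) : Set (Fam K A (Fin n)) :=
  {V | V ∈ partialFlags K A k ∧ (∀ j, Submodule.map x (V j) ≤ V j) ∧
    ∀ j, Submodule.map (s : Module.End K A) (V j) = V j}

/-- The partial flags with `dim (V_j ∩ ker x^i) = α_{i,j}` for `1 ≤ i ≤ m` and all `j`. -/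
def relPosition (x : Module.End K A) (m : ℕ) {n : ℕ} (k : Fin n → ℕ) (α : ℕ → Fin n → ℤ) :
    Set (Fam K A (Fin n)) :=
  {V | V ∈ partialFlags K A k ∧ ∀ i, 1 ≤ i → i ≤ m → ∀ j,
    (Module.finrank K (V j ⊓ LinearMap.ker (x ^ i) : Submodule K A) : ℤ) = α i j}

/-- The admissibility inequalities on the matrix `α` (only the entries `α i j` with `1 ≤ i ≤ m`
matter), where `l i = dim ker x^i`. -/
structure Admissible (x : Module.End K A) (m : ℕ) {n : ℕ} (k : Fin n → ℕ)
    (α : ℕ → Fin n → ℤ) : Prop where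
  mono : ∀ i i' j j', 1 ≤ i → i ≤ i' → i' ≤ m → j ≤ j' → 0 ≤ α i j ∧ α i j ≤ α i' j'
  top : 1 ≤ m → ∀ j, α m j = k j
  diff_le : ∀ i i' j j', 2 ≤ i → i ≤ i' → i' ≤ m → j' ≤ j →
    α i' j' - α (i' - 1) j' ≤ α i j - α (i - 1) j ∧ α i j - α (i - 1) j ≤ α 1 j
  diff_le_ker : ∀ i j, 2 ≤ i → i ≤ m → α i j - α (i - 1) j ≤
    (Module.finrank K (LinearMap.ker (x ^ i)) : ℤ)
      - Module.finrank K (LinearMap.ker (x ^ (i - 1)))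
  first_le_ker : 1 ≤ m → ∀ j, α 1 j ≤ Module.finrank K (LinearMap.ker (x ^ 1))

/-- The subspaces `A_i = x^(m-i) (ker x^(m-i+1))`, `1 ≤ i ≤ m`. -/
def imgKer (x : Module.End K A) (m : ℕ) (i : Set.Icc 1 m) : Submodule K A :=
  Submodule.map (x ^ (m - (i : ℕ))) (LinearMap.ker (x ^ (m - (i : ℕ) + 1)))

/-- The matrix `κ` of the successive differences of `α`. -/
def kappa (m : ℕ) {n : ℕ} (α : ℕ → Fin n → ℤ) (i : Set.Icc 1 m) (j : Fin n) : ℤ :=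
  if (i : ℕ) < m then α (m - (i : ℕ) + 1) j - α (m - (i : ℕ)) j else α 1 j

/-- The map `(V_j)_j ↦ (x^(m-i) (V_j ∩ ker x^(m-i+1)))_{i,j}`. -/
def imgMap (x : Module.End K A) (m : ℕ) {n : ℕ} (V : Fam K A (Fin n)) :
    Fam K A (Set.Icc 1 m × Fin n) :=
  fun t => Submodule.map (x ^ (m - (t.1 : ℕ)))
    (V t.2 ⊓ LinearMap.ker (x ^ (m - (t.1 : ℕ) + 1)))

end Flags

end NilFlag

namespace NilFlag

/-! ### Polynomial functions and linear independence as an open condition. -/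

section Polynomial

variable {K W W' A : Type*} [Field K] [AddCommGroup W] [Module K W] [AddCommGroup W'] [Module K W']
  [AddCommGroup A] [Module K A]

/-! The element `s` turns everything into linear algebra on a graded space. As `K` is algebraically
closed and `s` is semisimple, `A` and all `ker x^r` are sums of eigenspaces of `s` intersected with
them. Transvections test the Levi condition. Those commuting with `s` lie in the parabolic, so an
eigenspace that meets `ker x^i` nontrivially lies inside it (`IsAdapted.eigenspace_le`). Since the
centralizer and the unipotent radical generate the parabolic, two eigenvalues cannot occur in one
quotient `ker x^(r+1) / ker x^r` (`IsAdapted.eigenvalue_unique`). Together with `s x = q x s` this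
gives `A = B_0 ⊕ ... ⊕ B_{m-1}`, with the `B_r` eigenspaces, `x B_{r+1} ⊆ B_r`, and `ker x^i` the
sum of the `B_r` with `r < i`. The `s`-stable subspaces are exactly the graded ones
(`exists_isGrading`).

For (a), let `p` be the projection onto `ker x^i` along the grading. For graded `V` the dimension of
`V ∩ ker x^i` is the rank of `p` on `V`, and the ranks of `p` and `1 - p` on `V` add up to `dim V`.
Both are lower semicontinuous, so both are locally constant when `dim V` is fixed.

For (b), `x^e` is injective on `B_e`, and `x^e (V ∩ ker x^(e+1))` is the image under `x^e` of the
degree `e` part of `V`. A graded `V` is thus the same as a family of subspaces of the `A_i`, and `V`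
is `x`-stable when this family increases with `i`. The map and its inverse send a family to sums of
images under fixed linear maps, with values of constant dimension. Such maps lift locally to linear
maps of frames, hence are morphisms (`isMorphismOn_of_linear`). -/

theorem dual_mem_polyFun (l : Module.Dual K W) : (l : W → K) ∈ polyFun K W :=
  Algebra.subset_adjoin ⟨l, rfl⟩

theorem comp_mem_polyFun (L : W →ₗ[K] W') {P : W' → K} (hP : P ∈ polyFun K W') :
    (fun w => P (L w)) ∈ polyFun K W := by
  induction hP using Algebra.adjoin_induction with
  | mem P hP =>
    obtain ⟨l, rfl⟩ := hP
    exact dual_mem_polyFun (l ∘ₗ L)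
  | algebraMap c => exact (polyFun K W).algebraMap_mem c
  | add P Q _ _ hP hQ => exact add_mem hP hQ
  | mul P Q _ _ hP hQ => exact mul_mem hP hQ

theorem det_mem_polyFun {d : Type*} [Fintype d] [DecidableEq d] (M : d → d → W → K)
    (hM : ∀ a b, M a b ∈ polyFun K W) :
    (fun w => (Matrix.of fun a b => M a b w).det) ∈ polyFun K W := by
  have h : (fun w => (Matrix.of fun a b => M a b w).det)
      = ∑ σ : Equiv.Perm d, Equiv.Perm.sign σ • ∏ i, M (σ i) i := by
    ext w
    simp [Matrix.det_apply, Finset.sum_apply, Finset.prod_apply, Units.smul_def]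
  rw [h]
  refine sum_mem fun σ _ => ?_
  rw [Units.smul_def]
  exact zsmul_mem (prod_mem fun i _ => hM _ _) _

/-- The coordinate forms on the span of `v`, extended to `A`. They make the determinant below equal
to 1 at the given point. -/
theorem exists_dual_eq_ite {d : Type*} [DecidableEq d] {v : d → A} (hv : LinearIndependent K v) :
    ∃ l : d → Module.Dual K A, ∀ a b, l b (v a) = if a = b then 1 else 0 := by
  have h (b : d) : ∃ l : Module.Dual K A, ∀ a, l (v a) = if a = b then 1 else 0 := by
    obtain ⟨l, hl⟩ := LinearMap.exists_extend ((Module.Basis.span hv).coord b)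
    refine ⟨l, fun a => ?_⟩
    have h1 : l (v a) = (l ∘ₗ Submodule.subtype _) (Module.Basis.span hv a) := by
      simp [Module.Basis.span_apply]
    rw [h1, hl]
    simp [Finsupp.single_apply]
  choose l hl using h
  exact ⟨l, fun a b => hl b a⟩

theorem linearIndependent_of_det_ne_zero {d : Type*} [Fintype d] [DecidableEq d] {v : d → A}
    (l : d → Module.Dual K A) (h : (Matrix.of fun a b => l b (v a)).det ≠ 0) :
    LinearIndependent K v := by
  rw [Fintype.linearIndependent_iff]
  intro c hc
  refine congrFun (Matrix.eq_zero_of_vecMul_eq_zero h (v := c) ?_)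
  ext b
  simpa [Matrix.vecMul, dotProduct] using congrArg (l b) hc

/-- Linear independence of the values of linear maps is a Zariski open condition. -/
theorem exists_polyFun_linearIndependent {d : Type*} [Fintype d] (u : d → W →ₗ[K] A) {f : W}
    (hf : LinearIndependent K fun a => u a f) :
    ∃ Q ∈ polyFun K W, Q f ≠ 0 ∧ ∀ g, Q g ≠ 0 → LinearIndependent K fun a => u a g := by
  classical
  obtain ⟨l, hl⟩ := exists_dual_eq_ite hf
  refine ⟨fun g => (Matrix.of fun a b => l b (u a g)).det,
    det_mem_polyFun _ fun a b => dual_mem_polyFun (l b ∘ₗ u a), ?_,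
    fun g hg => linearIndependent_of_det_ne_zero l hg⟩
  have h : (Matrix.of fun a b => l b (u a f)) = 1 := by
    ext a b
    simp [hl, Matrix.one_apply]
  simp [h]

end Polynomial

/-! ### Frames, morphisms and semicontinuity of rank. -/

section Morphism

variable {K A ι ι' : Type*} [Field K] [AddCommGroup A] [Module K A]

theorem finrank_spanFam {r : ι → ℕ} {g : Tuples A r} (hg : g ∈ frames K A r) (t : ι) :
    Module.finrank K (spanFam K g t) = r t :=
  (finrank_span_eq_card (hg t)).trans (Fintype.card_fin _)

/-- The evaluation of tuples at an index. -/
def tuplesEval (K A : Type*) {ι : Type*} [Field K] [AddCommGroup A] [Module K A] (r : ι → ℕ)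
    (t : ι) (a : Fin (r t)) : Tuples A r →ₗ[K] A where
  toFun f := f t a
  map_add' _ _ := rfl
  map_smul' _ _ := rfl

/-- The families spanned by the frames in a principal open set form an open set. -/
theorem isOpen_image_spanFam {r : ι → ℕ} {Q : Tuples A r → K} (hQ : Q ∈ polyFun K (Tuples A r)) :
    IsOpen {V : Fam K A ι | ∃ g ∈ frames K A r, Q g ≠ 0 ∧ spanFam K g = V} := by
  rintro r' f hf ⟨g, hg, hQg, hgf⟩
  obtain rfl : r = r' := by
    funext t
    rw [← finrank_spanFam hg t, hgf, finrank_spanFam hf t]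
  have hM : ∀ t a, ∃ c : Fin (r t) → K, ∑ b, c b • f t b = g t a := by
    intro t a
    rw [← Submodule.mem_span_range_iff_exists_fun]
    have h : spanFam K g t = spanFam K f t := by rw [hgf]
    exact h.le (Submodule.subset_span ⟨a, rfl⟩)
  choose M hM using hM
  -- The constant matrix `M` that takes the frame `f` to `g` is applied to every tuple. It changes
  -- no span of a frame, so `Q ∘ L` can serve as the polynomial near `f`.
  let L : Tuples A r →ₗ[K] Tuples A r :=
    LinearMap.pi fun t => LinearMap.pi fun a =>
      ∑ b, M t a b • tuplesEval K A r t b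
  have hL (h : Tuples A r) (t : ι) (a : Fin (r t)) : L h t a = ∑ b, M t a b • h t b := by
    simp [L, tuplesEval]
  have hLf : L f = g := by
    ext t a
    rw [hL, hM]
  refine ⟨fun h => Q (L h), comp_mem_polyFun L hQ, (congrArg Q hLf).trans_ne hQg, fun h hh hne => ?_⟩
  have hLh : L h ∈ frames K A r := by
    intro t
    rw [Fintype.linearIndependent_iff]
    intro c hc
    have key (h : Tuples A r) :
        ∑ a, c a • L h t a = ∑ b, (∑ a, c a * M t a b) • h t b := by
      simp only [hL, Finset.smul_sum, Finset.sum_smul, smul_smul]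
      exact Finset.sum_comm
    rw [key] at hc
    have h0 := Fintype.linearIndependent_iff.1 (hh t) _ hc
    refine Fintype.linearIndependent_iff.1 (hg t) c ?_
    rw [← hLf, key]
    simp [h0]
  refine ⟨L h, hLh, hne, ?_⟩
  funext t
  have hfin : FiniteDimensional K (spanFam K h t) :=
    FiniteDimensional.span_of_finite K (Set.finite_range _)
  refine Submodule.eq_of_le_of_finrank_eq (Submodule.span_le.2 ?_) ?_
  · rintro _ ⟨a, rfl⟩
    rw [hL]
    exact sum_mem fun b _ => Submodule.smul_mem _ _ (Submodule.subset_span ⟨b, rfl⟩)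
  · exact (finrank_spanFam hLh t).trans (finrank_spanFam hh t).symm

theorem exists_frame [FiniteDimensional K A] (V : Fam K A ι) :
    ∃ r : ι → ℕ, ∃ f ∈ frames K A r, spanFam K f = V := by
  have h (t : ι) : ∃ f : Fin (Module.finrank K (V t)) → A,
      LinearIndependent K f ∧ Submodule.span K (Set.range f) = V t := by
    refine ⟨fun a => Module.finBasis K (V t) a, ?_, ?_⟩
    · exact (Module.finBasis K (V t)).linearIndependent.map' (V t).subtype (Submodule.ker_subtype _)
    · have h1 : (Set.range fun a => (Module.finBasis K (V t) a : A))
          = (V t).subtype '' Set.range (Module.finBasis K (V t)) := by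
        rw [← Set.range_comp]; rfl
      rw [h1, Submodule.span_image, Module.Basis.span_eq, Submodule.map_subtype_top]
  choose f hf hfV using h
  exact ⟨_, f, hf, funext hfV⟩

/-- A map that lifts locally to linear maps of frames is a morphism. -/
theorem isMorphismOn_of_lift [FiniteDimensional K A] {X : Set (Fam K A ι)} {Y : Set (Fam K A ι')}
    {F : Fam K A ι → Fam K A ι'} (hXY : Set.MapsTo F X Y) (d : ι' → ℕ)
    (h : ∀ r : ι → ℕ, ∀ f ∈ frames K A r, spanFam K f ∈ X →
      ∃ Q ∈ polyFun K (Tuples A r), Q f ≠ 0 ∧ ∃ Φ : Tuples A r →ₗ[K] Tuples A d,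
        ∀ g ∈ frames K A r, spanFam K g ∈ X → Q g ≠ 0 →
          Φ g ∈ frames K A d ∧ spanFam K (Φ g) = F (spanFam K g)) :
    IsMorphismOn X Y F := by
  refine ⟨hXY, ?_, ?_⟩
  · rw [continuousOn_iff']
    intro U hU
    -- This is the largest open set whose trace on `X` is mapped into `U`.
    refine ⟨interior {V | V ∈ X → F V ∈ U}, isOpen_interior, ?_⟩
    ext V
    refine ⟨fun ⟨hVU, hVX⟩ => ⟨?_, hVX⟩, fun ⟨hV, hVX⟩ => ⟨interior_subset hV hVX, hVX⟩⟩
    obtain ⟨r, f, hf, rfl⟩ := exists_frame V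
    obtain ⟨Q, hQ, hQf, Φ, hΦ⟩ := h r f hf hVX
    obtain ⟨h1, h2⟩ := hΦ f hf hVX hQf
    obtain ⟨R, hR, hRf, hRU⟩ := hU d (Φ f) h1 (h2 ▸ hVU)
    refine mem_interior.2 ⟨_, ?_, isOpen_image_spanFam (mul_mem hQ (comp_mem_polyFun Φ hR)),
      f, hf, mul_ne_zero hQf hRf, rfl⟩
    rintro _ ⟨g, hg, hne, rfl⟩ hgX
    obtain ⟨h3, h4⟩ := hΦ g hg hgX (left_ne_zero_of_mul hne)
    exact h4 ▸ hRU _ h3 (right_ne_zero_of_mul hne)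
  · intro U hU φ hφ r f hf hfU
    obtain ⟨Q, hQ, hQf, Φ, hΦ⟩ := h r f hf hfU.1
    obtain ⟨h1, h2⟩ := hΦ f hf hfU.1 hQf
    obtain ⟨P, hP, R, hR, hRf, hPR⟩ := hφ d (Φ f) h1 (h2 ▸ ⟨hXY hfU.1, hfU.2⟩)
    -- The common factor `Q` confines the quotient to the locus where the lift `Φ` is valid.
    refine ⟨fun g => Q g * P (Φ g), mul_mem hQ (comp_mem_polyFun Φ hP),
      fun g => Q g * R (Φ g), mul_mem hQ (comp_mem_polyFun Φ hR), mul_ne_zero hQf hRf, ?_⟩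
    intro g hg hgU hne
    obtain ⟨h3, h4⟩ := hΦ g hg hgU.1 (left_ne_zero_of_mul hne)
    have h5 := hPR (Φ g) h3 (h4 ▸ ⟨hXY hgU.1, hgU.2⟩) (right_ne_zero_of_mul hne)
    rw [Function.comp_apply, ← h4, h5, mul_div_mul_left _ _ (left_ne_zero_of_mul hne)]

theorem exists_linearIndependent_comp {σ : Type*} [Finite σ] (v : σ → A) :
    ∃ c : Fin (Module.finrank K (Submodule.span K (Set.range v))) → σ,
      LinearIndependent K (v ∘ c) ∧
        Submodule.span K (Set.range (v ∘ c)) = Submodule.span K (Set.range v) := by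
  have := FiniteDimensional.span_of_finite K (Set.finite_range v)
  obtain ⟨f, hf, hspan, hli⟩ := Submodule.exists_fun_fin_finrank_span_eq K (Set.range v)
  choose c hc using hf
  obtain rfl : v ∘ c = f := funext hc
  exact ⟨c, hli, hspan⟩

/-- A map which is given on `X` by sums of images of linear maps, and takes values of constant
dimension, is a morphism. -/
theorem isMorphismOn_of_linear [Finite ι] [Finite ι'] [FiniteDimensional K A]
    {X : Set (Fam K A ι)} {Y : Set (Fam K A ι')} {F : Fam K A ι → Fam K A ι'}
    (hXY : Set.MapsTo F X Y) (T : ι' → ι → Module.End K A)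
    (hF : ∀ V ∈ X, ∀ t', F V t' = ⨆ t, Submodule.map (T t' t) (V t))
    (d : ι' → ℕ) (hd : ∀ V ∈ X, ∀ t', Module.finrank K (F V t') = d t') :
    IsMorphismOn X Y F := by
  refine isMorphismOn_of_lift hXY d fun r f hf hfX => ?_
  have := Fintype.ofFinite ι'
  let w (t' : ι') (e : Σ t, Fin (r t)) : Tuples A r →ₗ[K] A :=
    T t' e.1 ∘ₗ tuplesEval K A r e.1 e.2
  have hw (g : Tuples A r) (hg : spanFam K g ∈ X) (t' : ι') :
      Submodule.span K (Set.range fun e => w t' e g) = F (spanFam K g) t' := by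
    rw [hF _ hg, Set.range_sigma_eq_iUnion_range, Submodule.span_iUnion]
    refine iSup_congr fun t => ?_
    rw [spanFam, Submodule.map_span, ← Set.range_comp]
    rfl
  have h (t' : ι') : ∃ c : Fin (d t') → Σ t, Fin (r t),
      LinearIndependent K fun a => w t' (c a) f := by
    have h := exists_linearIndependent_comp (K := K) fun e => w t' e f
    rw [hw f hfX t', hd _ hfX t'] at h
    exact h.imp fun c hc => hc.1
  choose c hc using h
  choose Q hQ hQf hQc using fun t' =>
    exists_polyFun_linearIndependent (fun a => w t' (c t' a)) (hc t')
  refine ⟨∏ t', Q t', prod_mem fun t' _ => hQ t', ?_,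
    LinearMap.pi fun t' => LinearMap.pi fun a => w t' (c t' a), fun g hg hgX hne => ?_⟩
  · rw [Finset.prod_apply]
    exact Finset.prod_ne_zero_iff.2 fun t' _ => hQf t'
  · rw [Finset.prod_apply, Finset.prod_ne_zero_iff] at hne
    have hli (t') := hQc t' g (hne t' (Finset.mem_univ _))
    refine ⟨hli, funext fun t' => ?_⟩
    -- The vectors chosen at `f` may span too little elsewhere on `X`; independence and the constant
    -- dimension `d` exclude this.
    refine Submodule.eq_of_le_of_finrank_eq ?_ ?_
    · rw [← hw g hgX]
      refine Submodule.span_mono ?_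
      rintro _ ⟨a, rfl⟩
      exact ⟨c t' a, rfl⟩
    · rw [hd _ hgX]
      exact (finrank_span_eq_card (hli t')).trans (Fintype.card_fin _)

/-- The rank of a linear map on a member of a family is a lower semicontinuous function. -/
theorem isOpen_le_finrank_map (T : Module.End K A) (t : ι) (d : ℕ) :
    IsOpen {V : Fam K A ι | d ≤ Module.finrank K (Submodule.map T (V t))} := by
  intro r f hf hfd
  have hspan (g : Tuples A r) : Submodule.span K (Set.range fun a => T (g t a))
      = Submodule.map T (spanFam K g t) := by
    rw [spanFam, Submodule.map_span, ← Set.range_comp]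
    rfl
  obtain ⟨c, hc, -⟩ := exists_linearIndependent_comp (K := K) fun a => T (f t a)
  obtain ⟨Q, hQ, hQf, h⟩ := exists_polyFun_linearIndependent
    (fun a => T ∘ₗ tuplesEval K A r t (c a)) hc
  refine ⟨Q, hQ, hQf, fun g _ hne => ?_⟩
  have h1 := finrank_span_eq_card (h g hne)
  have h2 := congrArg (fun V : Submodule K A => Module.finrank K V) (hspan f)
  refine le_trans (hfd.trans (h2.symm.trans ((Fintype.card_fin _).symm.trans h1.symm)).le) ?_
  have := FiniteDimensional.span_of_finite K (Set.finite_range fun a => T (g t a))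
  have h3 := congrArg (fun V : Submodule K A => Module.finrank K V) (hspan g)
  refine le_trans ?_ h3.le
  refine Submodule.finrank_mono (Submodule.span_mono ?_)
  rintro _ ⟨a, rfl⟩
  exact ⟨c a, rfl⟩

end Morphism

/-! ### What the Levi condition says about the eigenspaces of `s`. -/

section Eigenspaces

open Module.End

variable {K A : Type*} [Field K] [AddCommGroup A] [Module K A]

theorem mem_ker_pow_succ {x : Module.End K A} {i : ℕ} {v : A} :
    v ∈ LinearMap.ker (x ^ (i + 1)) ↔ x v ∈ LinearMap.ker (x ^ i) := by
  rw [LinearMap.mem_ker, LinearMap.mem_ker, pow_succ, Module.End.mul_apply]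

theorem ker_pow_mono (x : Module.End K A) {i i' : ℕ} (h : i ≤ i') :
    LinearMap.ker (x ^ i) ≤ LinearMap.ker (x ^ i') := by
  intro v hv
  rw [LinearMap.mem_ker] at hv ⊢
  rw [← Nat.sub_add_cancel h, pow_add, Module.End.mul_apply, hv, map_zero]

/-- An eigenvector of a semisimple endomorphism is detected by a linear form which is an
eigenvector of the transpose. -/
theorem exists_dual_eigenvector {s : Module.End K A} (hs : s.IsSemisimple) {c : K} {v : A}
    (hv : v ∈ s.eigenspace c) (hv0 : v ≠ 0) :
    ∃ l : Module.Dual K A, l v = 1 ∧ ∀ u, l (s u) = c * l u := by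
  have hv' : v ∉ LinearMap.range (s - algebraMap K (Module.End K A) c) := by
    rintro ⟨u, rfl⟩
    -- If `v = (s - c) u`, then `(s - c)^2 u = 0`, and semisimplicity forces `v = 0`.
    have h : u ∈ s.genEigenspace c 2 := by
      rw [mem_eigenspace_iff] at hv
      simp only [LinearMap.sub_apply, Module.algebraMap_end_apply] at hv
      rw [show (2 : ℕ∞) = ((2 : ℕ) : ℕ∞) from rfl, mem_genEigenspace_nat, LinearMap.mem_ker, pow_two,
        Module.End.mul_apply]
      simp only [LinearMap.sub_apply, LinearMap.smul_apply, Module.End.one_apply]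
      rw [hv, sub_self]
    rw [hs.isFinitelySemisimple.genEigenspace_eq_eigenspace c (by norm_num)] at h
    rw [mem_eigenspace_iff] at h
    apply hv0
    simp [h]
  obtain ⟨l, hl, hle⟩ := Submodule.exists_le_ker_of_notMem hv'
  refine ⟨(l v)⁻¹ • l, by simp [hl], fun u => ?_⟩
  have h : l ((s - algebraMap K (Module.End K A) c) u) = 0 := hle ⟨u, rfl⟩
  simp only [LinearMap.sub_apply, Module.algebraMap_end_apply, map_sub, map_smul, sub_eq_zero,
    smul_eq_mul] at h
  simp only [LinearMap.smul_apply, h, smul_eq_mul]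
  ring

/-- The subgroup of `GL(A)` stabilizing a subspace. -/
def stabilizer (S : Submodule K A) : Subgroup (LinearMap.GeneralLinearGroup K A) where
  carrier := {g | ∀ v : A, (g : Module.End K A) v ∈ S ↔ v ∈ S}
  mul_mem' := by
    intro a b ha hb v
    have h : ((a * b : LinearMap.GeneralLinearGroup K A) : Module.End K A) v
        = (a : Module.End K A) ((b : Module.End K A) v) := rfl
    rw [h, ha, hb]
  one_mem' := fun _ => Iff.rfl
  inv_mem' := by
    intro a ha v
    have h : (a : Module.End K A)
        (((a⁻¹ : LinearMap.GeneralLinearGroup K A) : Module.End K A) v) = v := by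
      rw [← Module.End.mul_apply, Units.mul_inv, Module.End.one_apply]
    rw [← ha, h]

theorem inv_apply_apply (g : LinearMap.GeneralLinearGroup K A) (v : A) :
    ((g⁻¹ : LinearMap.GeneralLinearGroup K A) : Module.End K A) ((g : Module.End K A) v) = v := by
  rw [← Module.End.mul_apply, Units.inv_mul, Module.End.one_apply]

theorem le_stabilizer {S : Submodule K A} {H : Subgroup (LinearMap.GeneralLinearGroup K A)}
    (h : ∀ g ∈ H, ∀ v ∈ S, (g : Module.End K A) v ∈ S) : H ≤ stabilizer S := by
  refine fun g hg v => ⟨fun hv => ?_, h g hg v⟩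
  have h1 := h _ (inv_mem hg) _ hv
  rwa [inv_apply_apply] at h1

/-- The transvection `u ↦ u + l(u) w` as an element of `GL(A)`. -/
theorem exists_transvection (l : Module.Dual K A) {w : A} (hw : l w = 0) :
    ∃ g : LinearMap.GeneralLinearGroup K A, ∀ u, (g : Module.End K A) u = u + l u • w :=
  ⟨(LinearMap.GeneralLinearGroup.generalLinearEquiv K A).symm (LinearEquiv.transvection hw),
    fun _ => rfl⟩

variable {x : Module.End K A} {s : LinearMap.GeneralLinearGroup K A}

theorem IsAdapted.apply_apply (hs : IsAdapted x s) :
    ∃ q : K, ∀ v, (s : Module.End K A) (x v) = q • x ((s : Module.End K A) v) := by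
  obtain ⟨q, -, h⟩ := hs.conj
  refine ⟨q, fun v => ?_⟩
  have h1 := LinearMap.congr_fun h ((s : Module.End K A) v)
  rwa [Module.End.mul_apply, inv_apply_apply] at h1

/-- An eigenspace of `s` is contained in `ker x^i` as soon as it meets it nontrivially. -/
theorem IsAdapted.eigenspace_le (hs : IsAdapted x s) {c : K} {i : ℕ} {v : A}
    (hv : v ∈ eigenspace (s : Module.End K A) c) (hv0 : v ≠ 0) (hvi : v ∈ LinearMap.ker (x ^ i)) :
    eigenspace (s : Module.End K A) c ≤ LinearMap.ker (x ^ i) := by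
  intro w hw
  obtain ⟨l, hlv, hl⟩ := exists_dual_eigenvector hs.semisimple hv hv0
  have hw' : w - l w • v ∈ eigenspace (s : Module.End K A) c :=
    sub_mem hw (Submodule.smul_mem _ _ hv)
  -- This transvection commutes with `s` and moves `v` by `w - l w • v`; as it preserves `ker x^i`,
  -- it puts `w` there.
  obtain ⟨g, hg⟩ := exists_transvection l (w := w - l w • v) (by simp [hlv])
  have hgs : g ∈ Subgroup.centralizer {s} := by
    rw [Subgroup.mem_centralizer_singleton_iff]
    refine Units.ext (LinearMap.ext fun u => ?_)
    change (g : Module.End K A) ((s : Module.End K A) u)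
      = (s : Module.End K A) ((g : Module.End K A) u)
    rw [hg, hg, map_add, map_smul, hl, mem_eigenspace_iff.1 hw', smul_smul, mul_comm]
  have hgP : g ∈ parabolic x := hs.levi.2 ▸ Subgroup.mem_sup_left hgs
  have h := (hgP i v).2 hvi
  rw [hg, hlv, one_smul] at h
  have h1 := sub_mem h hvi
  rw [add_sub_cancel_left] at h1
  simpa using add_mem h1 (Submodule.smul_mem _ (l w) hvi)

/-- The members of `ker x^r` have components only in the eigenspaces contained in it. -/
theorem IsAdapted.ker_pow_eq [IsAlgClosed K] [FiniteDimensional K A] (hs : IsAdapted x s) (r : ℕ) :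
    LinearMap.ker (x ^ r)
      = ⨆ c, LinearMap.ker (x ^ r) ⊓ eigenspace (s : Module.End K A) c := by
  refine Submodule.eq_iSup_inf_genEigenspace 1 (fun v hv => (hs.mem_parabolic r v).2 hv) ?_
  rw [← iSup_maxGenEigenspace_eq_top (s : Module.End K A)]
  exact iSup_congr fun c =>
    (hs.semisimple.isFinitelySemisimple.maxGenEigenspace_eq_eigenspace c).symm

/-- Only one eigenvalue of `s` occurs in each of the quotients `ker x^(r+1) / ker x^r`. -/
theorem IsAdapted.eigenvalue_unique [IsAlgClosed K] [FiniteDimensional K A] (hs : IsAdapted x s)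
    {r : ℕ} {c c' : K} {v w : A}
    (hv : v ∈ eigenspace (s : Module.End K A) c) (hvr : v ∈ LinearMap.ker (x ^ (r + 1)))
    (hv' : v ∉ LinearMap.ker (x ^ r))
    (hw : w ∈ eigenspace (s : Module.End K A) c') (hwr : w ∈ LinearMap.ker (x ^ (r + 1)))
    (hw' : w ∉ LinearMap.ker (x ^ r)) : c = c' := by
  by_contra hne
  have hv0 : v ≠ 0 := fun h => hv' (h ▸ zero_mem _)
  obtain ⟨l, hlv, hl⟩ := exists_dual_eigenvector hs.semisimple hv hv0
  have hl0 {b : K} (hb : c ≠ b) {u : A} (hu : u ∈ eigenspace (s : Module.End K A) b) :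
      l u = 0 := by
    have h := hl u
    rw [mem_eigenspace_iff.1 hu, map_smul, smul_eq_mul, ← sub_eq_zero, ← sub_mul] at h
    exact (mul_eq_zero.1 h).resolve_left (sub_ne_zero.2 (Ne.symm hb))
  have hlr : LinearMap.ker (x ^ r) ≤ LinearMap.ker l := by
    rw [hs.ker_pow_eq r]
    refine iSup_le fun b u hu => ?_
    by_cases hb : c = b
    · subst hb
      by_cases hu0 : u = 0
      · simp [hu0]
      · exact absurd (hs.eigenspace_le hu.2 hu0 hu.1 hv) hv'
    · exact hl0 hb hu.2
  -- It sends `v` to `v + w`. It preserves the flag of kernels because `l` kills `ker x^r` and `w`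
  -- lies in `ker x^(r+1)`.
  obtain ⟨g, hg⟩ := exists_transvection l (hl0 hne hw)
  have hgP : g ∈ parabolic x := by
    intro i u
    rw [hg]
    rcases Nat.lt_or_ge r i with hi | hi
    · exact Submodule.add_mem_iff_left _ (Submodule.smul_mem _ _ (ker_pow_mono x hi hwr))
    · have key {u : A} (hu : u ∈ LinearMap.ker (x ^ i)) : l u = 0 :=
        hlr (ker_pow_mono x hi hu)
      constructor
      · intro hu
        have h1 := key hu
        rw [map_add, map_smul, hl0 hne hw, smul_zero, add_zero] at h1
        simpa [h1] using hu
      · intro hu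
        simpa [key hu] using hu
  -- The centralizer preserves the eigenspace and `ker x^r`; the radical acts trivially on `ker
  -- x^(r+1)` modulo `ker x^r`.
  have hstab : parabolic x
      ≤ stabilizer (eigenspace (s : Module.End K A) c ⊔ LinearMap.ker (x ^ r)) := by
    have hc : eigenspace (s : Module.End K A) c ≤ LinearMap.ker (x ^ (r + 1)) :=
      hs.eigenspace_le hv hv0 hvr
    rw [← hs.levi.2]
    refine sup_le (le_stabilizer fun h hh u hu => ?_) (le_stabilizer fun h hh u hu => ?_)
    · have hhP : h ∈ parabolic x := hs.levi.2 ▸ Subgroup.mem_sup_left hh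
      obtain ⟨a, ha, b, hb, rfl⟩ := Submodule.mem_sup.1 hu
      rw [map_add]
      refine add_mem (Submodule.mem_sup_left ?_) (Submodule.mem_sup_right ((hhP r b).2 hb))
      rw [Subgroup.mem_centralizer_singleton_iff] at hh
      have h2 : (h : Module.End K A) ((s : Module.End K A) a)
          = (s : Module.End K A) ((h : Module.End K A) a) :=
        congrArg (fun f : LinearMap.GeneralLinearGroup K A => (f : Module.End K A) a) hh
      rw [mem_eigenspace_iff, ← h2, mem_eigenspace_iff.1 ha, map_smul]
    · have hu' : u ∈ LinearMap.ker (x ^ (r + 1)) :=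
        sup_le hc (ker_pow_mono x r.le_succ) hu
      simpa using add_mem (Submodule.mem_sup_right (hh.2 r u hu')) hu
  have h1 := (hstab hgP v).2 (Submodule.mem_sup_left hv)
  rw [hg, hlv, one_smul] at h1
  have h2 := sub_mem h1 (Submodule.mem_sup_left hv)
  rw [add_sub_cancel_left] at h2
  obtain ⟨a, ha, b, hb, hab⟩ := Submodule.mem_sup.1 h2
  -- Applying `s - c` to `w = a + b` kills `a`, so a nonzero multiple of `w` falls into `ker x^r`.
  have h3 : (s : Module.End K A) b - c • b = (c' - c) • w := by
    obtain rfl : b = w - a := by rw [← hab, add_sub_cancel_left]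
    rw [map_sub, mem_eigenspace_iff.1 hw, mem_eigenspace_iff.1 ha]
    module
  have h4 : (c' - c) • w ∈ LinearMap.ker (x ^ r) :=
    h3 ▸ sub_mem ((hs.mem_parabolic r b).2 hb) (Submodule.smul_mem _ _ hb)
  exact hw' ((Submodule.smul_mem_iff _ (sub_ne_zero.2 (Ne.symm hne))).1 h4)

end Eigenspaces

/-! ### The grading of `A` by the eigenspaces of `s`. -/

section Grading

open Module.End

variable {K A : Type*} [Field K] [AddCommGroup A] [Module K A]

/-- The projections onto the summands of a grading `A = B_0 ⊕ ... ⊕ B_{m-1}` such that `x` has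
degree `-1` and kernel `B_0`. -/
structure IsGrading (x : Module.End K A) (m : ℕ) (π : ℕ → Module.End K A) : Prop where
  comp : ∀ r r' v, π r (π r' v) = if r = r' then π r v else 0
  sum : ∀ v, ∑ r ∈ Finset.range m, π r v = v
  semiconj : ∀ r v, π r (x v) = x (π (r + 1) v)
  ker : ∀ v, x v = 0 ↔ π 0 v = v

variable {x : Module.End K A} {s : LinearMap.GeneralLinearGroup K A}

/-- Otherwise the kernels stabilize at `r`, and `x^r = 0` contradicts the minimality of the
nilpotency class. -/
theorem exists_mem_eigenspace [IsAlgClosed K] [FiniteDimensional K A] (hs : IsAdapted x s)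
    (hx : IsNilpotent x) {r : ℕ} (hr : r < nilpotencyClass x) :
    ∃ c, ∃ v ∈ eigenspace (s : Module.End K A) c,
      v ∈ LinearMap.ker (x ^ (r + 1)) ∧ v ∉ LinearMap.ker (x ^ r) := by
  by_contra! h
  have hle : LinearMap.ker (x ^ (r + 1)) ≤ LinearMap.ker (x ^ r) := by
    rw [hs.ker_pow_eq (r + 1)]
    exact iSup_le fun c v hv => h c v hv.2 hv.1
  have h1 := ker_pow_constant (le_antisymm (ker_pow_mono x r.le_succ) hle)
    (nilpotencyClass x - r)
  rw [Nat.add_sub_cancel' hr.le, pow_nilpotencyClass hx, LinearMap.ker_zero,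
    LinearMap.ker_eq_top] at h1
  exact absurd (Nat.sInf_le h1) (not_le.2 hr)

theorem exists_isGrading [IsAlgClosed K] [FiniteDimensional K A] (hs : IsAdapted x s)
    (hx : IsNilpotent x) :
    ∃ π : ℕ → Module.End K A, IsGrading x (nilpotencyClass x) π ∧
      ∀ V : Submodule K A, Submodule.map (s : Module.End K A) V = V ↔
        ∀ r, ∀ v ∈ V, π r v ∈ V := by
  classical
  have hc : ∃ c : ℕ → K, ∀ r < nilpotencyClass x, ∃ v ∈ eigenspace (s : Module.End K A) (c r),
      v ∈ LinearMap.ker (x ^ (r + 1)) ∧ v ∉ LinearMap.ker (x ^ r) := by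
    have h (r : ℕ) : ∃ c : K, r < nilpotencyClass x →
        ∃ v ∈ eigenspace (s : Module.End K A) c,
          v ∈ LinearMap.ker (x ^ (r + 1)) ∧ v ∉ LinearMap.ker (x ^ r) := by
      by_cases hr : r < nilpotencyClass x
      · exact (exists_mem_eigenspace hs hx hr).imp fun c h _ => h
      · exact ⟨0, fun h => absurd h hr⟩
    choose c hc using h
    exact ⟨c, hc⟩
  have hxm := pow_nilpotencyClass hx
  generalize nilpotencyClass x = m at hc hxm ⊢
  obtain ⟨c, hc⟩ := hc
  have hE (r : ℕ) (hr : r < m) :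
      eigenspace (s : Module.End K A) (c r) ≤ LinearMap.ker (x ^ (r + 1)) := by
    obtain ⟨v, hv, hvr, hv'⟩ := hc r hr
    exact hs.eigenspace_le hv (fun h => hv' (h ▸ zero_mem _)) hvr
  have hE0 (r : ℕ) (hr : r < m) {u : A} (hu : u ∈ eigenspace (s : Module.End K A) (c r))
      (hur : u ∈ LinearMap.ker (x ^ r)) : u = 0 := by
    by_contra hu0
    obtain ⟨v, hv, hvr, hv'⟩ := hc r hr
    exact hv' (hs.eigenspace_le hu hu0 hur hv)
  have huniq (r : ℕ) (hr : r < m) {b : K} {u : A} (hu : u ∈ eigenspace (s : Module.End K A) b)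
      (hur : u ∈ LinearMap.ker (x ^ (r + 1))) (hu' : u ∉ LinearMap.ker (x ^ r)) : b = c r := by
    obtain ⟨v, hv, hvr, hv'⟩ := hc r hr
    exact hs.eigenvalue_unique hu hur hu' hv hvr hv'
  have hinj : Set.InjOn c (Finset.range m) := by
    intro r hr r' hr' h
    simp only [Finset.coe_range, Set.mem_Iio] at hr hr'
    by_contra hne
    wlog hlt : r < r' generalizing r r'
    · exact this h.symm hr' hr (fun h => hne h.symm) (by omega)
    obtain ⟨v, hv, -, hv'⟩ := hc r' hr'
    rw [← h] at hv
    exact hv' (ker_pow_mono x hlt (hE r hr hv))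
  have htop : ⨆ r, ⨆ _ : r < m, eigenspace (s : Module.End K A) (c r) = ⊤ := by
    have h := hs.ker_pow_eq m
    rw [hxm, LinearMap.ker_zero] at h
    rw [eq_top_iff, h]
    refine iSup_le fun b u ⟨_, hu⟩ => ?_
    by_cases hu0 : u = 0
    · exact hu0 ▸ zero_mem _
    -- The least `i` with `x^i u = 0` is some `r + 1`, and uniqueness then identifies the eigenvalue
    -- of `u` as `c r`.
    have hex : ∃ i, u ∈ LinearMap.ker (x ^ i) := ⟨m, by simp [hxm]⟩
    have hspec := Nat.find_spec hex
    have hmin : ∀ i < Nat.find hex, u ∉ LinearMap.ker (x ^ i) := fun i hi => Nat.find_min hex hi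
    have hle : Nat.find hex ≤ m := Nat.find_min' hex (by simp [hxm])
    generalize Nat.find hex = i at hspec hmin hle
    cases i with
    | zero => simp [hu0] at hspec
    | succ r =>
      obtain rfl := huniq r hle hu hspec (hmin r r.lt_succ_self)
      exact Submodule.mem_iSup_of_mem r (Submodule.mem_iSup_of_mem hle hu)
  have hext {f g : Module.End K A}
      (h : ∀ r < m, ∀ u ∈ eigenspace (s : Module.End K A) (c r), f u = g u) (u : A) :
      f u = g u := by
    have h1 : (⊤ : Submodule K A) ≤ LinearMap.eqLocus f g :=
      htop ▸ iSup_le fun r => iSup_le fun hr u hu => h r hr u hu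
    exact h1 Submodule.mem_top
  -- Taking the projections as polynomials in `s` makes them preserve every `s`-stable subspace.
  let π (r : ℕ) : Module.End K A :=
    if r < m then Polynomial.aeval (s : Module.End K A) (Lagrange.basis (Finset.range m) c r) else 0
  have hπ (r r' : ℕ) (hr' : r' < m) {u : A} (hu : u ∈ eigenspace (s : Module.End K A) (c r')) :
      π r u = if r = r' then u else 0 := by
    by_cases hr : r < m
    · simp only [π, if_pos hr]
      rw [aeval_apply_of_mem_apply_eq_smul (mem_eigenspace_iff.1 hu)]
      split_ifs with h
      · subst h
        rw [Lagrange.eval_basis_self hinj (Finset.mem_range.2 hr), one_smul]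
      · rw [Lagrange.eval_basis_of_ne h (Finset.mem_range.2 hr'), zero_smul]
    · simp [π, hr, (ne_of_lt (hr'.trans_le (not_lt.1 hr))).symm]
  have hπE (r : ℕ) (u : A) : π r u ∈ eigenspace (s : Module.End K A) (c r) := by
    rw [mem_eigenspace_iff]
    refine hext (f := (s : Module.End K A) * π r) (g := c r • π r) (fun r' hr' u hu => ?_) u
    rw [Module.End.mul_apply, LinearMap.smul_apply, hπ r r' hr' hu]
    split_ifs with h
    · subst h; exact mem_eigenspace_iff.1 hu
    · simp
  obtain ⟨q, hq⟩ := hs.apply_apply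
  have hstep (r : ℕ) (hr : r + 1 < m) {u : A}
      (hu : u ∈ eigenspace (s : Module.End K A) (c (r + 1))) :
      x u ∈ eigenspace (s : Module.End K A) (c r) := by
    have hx' {u : A} (hu : u ∈ eigenspace (s : Module.End K A) (c (r + 1))) :
        x u ∈ eigenspace (s : Module.End K A) (q * c (r + 1)) := by
      rw [mem_eigenspace_iff, hq, mem_eigenspace_iff.1 hu, map_smul, smul_smul]
    -- One witness `v` suffices to show `q * c (r + 1) = c r`, which then applies to the whole
    -- eigenspace.
    obtain ⟨v, hv, hvr, hv'⟩ := hc (r + 1) hr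
    rw [mem_ker_pow_succ] at hvr hv'
    rw [← huniq r (r.lt_succ_self.trans hr) (hx' hv) hvr hv']
    exact hx' hu
  have hx0 {u : A} (hm : 0 < m) (hu : u ∈ eigenspace (s : Module.End K A) (c 0)) : x u = 0 := by
    simpa using hE 0 hm hu
  have hsum (u : A) : ∑ r ∈ Finset.range m, π r u = u := by
    rw [← LinearMap.sum_apply]
    refine hext (g := LinearMap.id) (fun r hr u hu => ?_) u
    rw [LinearMap.sum_apply, Finset.sum_congr rfl fun r' _ => hπ r' r hr hu]
    simp [hr]
  have hsemi (r : ℕ) (u : A) : π r (x u) = x (π (r + 1) u) := by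
    refine hext (f := π r * x) (g := x * π (r + 1)) (fun r' hr' u hu => ?_) u
    rw [Module.End.mul_apply, Module.End.mul_apply, hπ (r + 1) r' hr' hu]
    cases r' with
    | zero => simp [hx0 hr' hu]
    | succ r' =>
      rw [hπ r r' (r'.lt_succ_self.trans hr') (hstep r' hr' hu)]
      by_cases h : r = r' <;> simp [h]
  have hπm (r : ℕ) (hr : m ≤ r) : π r = 0 := by simp [π, hr]
  refine ⟨π, ⟨fun r r' u => ?_, hsum, hsemi, fun u => ⟨fun hu => ?_, fun hu => ?_⟩⟩, fun V => ?_⟩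
  · by_cases hr' : r' < m
    · rw [hπ r r' hr' (hπE r' u)]
      by_cases h : r = r' <;> simp [h]
    · rw [hπm r' (not_lt.1 hr'), LinearMap.zero_apply, map_zero]
      split_ifs with h
      · rw [h, hπm r' (not_lt.1 hr'), LinearMap.zero_apply]
      · rfl
  · have h (r : ℕ) (hr : r + 1 < m) : π (r + 1) u = 0 := by
      refine hE0 (r + 1) hr (hπE _ _) ?_
      have h1 := hsemi r u
      rw [hu, map_zero] at h1
      rw [mem_ker_pow_succ, ← h1]
      exact zero_mem _
    conv_rhs => rw [← hsum u]
    cases m with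
    | zero => simp [hπm 0 le_rfl]
    | succ m =>
      rw [Finset.sum_range_succ', Finset.sum_eq_zero, zero_add]
      exact fun r hr => h r (Nat.succ_lt_succ (Finset.mem_range.1 hr))
  · by_cases hm : 0 < m
    · rw [← hu]
      exact hx0 hm (hπE 0 u)
    · rw [← hu, hπm 0 (not_lt.1 hm)]
      simp
  · constructor
    · intro hV r v hv
      by_cases hr : r < m
      · simp only [π, if_pos hr]
        exact Polynomial.aeval_apply_smul_mem_of_le_comap hv _ _
          (Submodule.map_le_iff_le_comap.1 hV.le)
      · simp [π, hr]
    · intro hV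
      have hle : Submodule.map (s : Module.End K A) V ≤ V := by
        rintro _ ⟨v, hv, rfl⟩
        rw [← hsum v, map_sum]
        refine sum_mem fun r _ => ?_
        rw [mem_eigenspace_iff.1 (hπE r v)]
        exact V.smul_mem _ (hV r v hv)
      refine Submodule.eq_of_le_of_finrank_eq hle
        (LinearEquiv.finrank_map_eq (LinearMap.GeneralLinearGroup.generalLinearEquiv K A s) V)

end Grading

/-! ### Dimension counts for powers of `x`. -/

section Rank

open Module

variable {K A : Type*} [Field K] [AddCommGroup A] [Module K A]

theorem finrank_inf_ker_pow_zero (x : Module.End K A) (V : Submodule K A) :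
    finrank K (V ⊓ LinearMap.ker (x ^ 0) : Submodule K A) = 0 := by
  rw [pow_zero, Module.End.one_eq_id, LinearMap.ker_id, inf_bot_eq, finrank_bot]

theorem map_pow_inf_mono {x : Module.End K A} {V V' : Submodule K A} (hV : V ≤ V')
    (hx : Submodule.map x V' ≤ V') {e e' : ℕ} (he : e' ≤ e) :
    Submodule.map (x ^ e) (V ⊓ LinearMap.ker (x ^ (e + 1)))
      ≤ Submodule.map (x ^ e') (V' ⊓ LinearMap.ker (x ^ (e' + 1))) := by
  rintro _ ⟨v, ⟨hv, hvk⟩, rfl⟩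
  have hpow (d : ℕ) : (x ^ d) v ∈ V' := by
    induction d with
    | zero => simpa using hV hv
    | succ d ih =>
      rw [pow_succ', Module.End.mul_apply]
      exact hx ⟨_, ih, rfl⟩
  refine ⟨(x ^ (e - e')) v, ⟨hpow _, ?_⟩, ?_⟩
  · rw [SetLike.mem_coe, LinearMap.mem_ker] at hvk ⊢
    rw [← Module.End.mul_apply, ← pow_add, show e' + 1 + (e - e') = e + 1 by omega, hvk]
  · rw [← Module.End.mul_apply, ← pow_add, Nat.add_sub_cancel' he]

variable [FiniteDimensional K A]

theorem finrank_map_add_finrank_inf_ker (f : Module.End K A) (V : Submodule K A) :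
    finrank K (Submodule.map f V) + finrank K (V ⊓ LinearMap.ker f : Submodule K A)
      = finrank K V := by
  have h := LinearMap.finrank_range_add_finrank_ker (f.domRestrict V)
  rwa [LinearMap.range_domRestrict, LinearMap.ker_domRestrict,
    ← Submodule.finrank_map_subtype_eq V, Submodule.map_comap_subtype] at h

theorem finrank_map_pow_add (x : Module.End K A) (e : ℕ) (V : Submodule K A) :
    finrank K (Submodule.map (x ^ e) (V ⊓ LinearMap.ker (x ^ (e + 1))))
        + finrank K (V ⊓ LinearMap.ker (x ^ e) : Submodule K A)
      = finrank K (V ⊓ LinearMap.ker (x ^ (e + 1)) : Submodule K A) := by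
  rw [← finrank_map_add_finrank_inf_ker (x ^ e) (V ⊓ LinearMap.ker (x ^ (e + 1))), inf_assoc,
    inf_eq_right.2 (ker_pow_mono x e.le_succ)]

end Rank

/-! ### The matrices `α` and `κ`. -/

section Numerics

open Module

variable {K A : Type*} [Field K] [AddCommGroup A] [Module K A] {x : Module.End K A} {m n : ℕ}
  {k : Fin n → ℕ} {α : ℕ → Fin n → ℤ}

/-- Both cases of `kappa` in terms of the exponent `e`. The row `α 0` is unconstrained, so it must
be replaced by zero explicitly. -/
theorem kappa_eq {i : Set.Icc 1 m} {e : ℕ} (h : m - (i : ℕ) = e) (j : Fin n) :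
    kappa m α i j = α (e + 1) j - if e = 0 then 0 else α e j := by
  subst h
  obtain ⟨i, h1, h2⟩ := i
  simp only [kappa]
  by_cases h : i < m
  · rw [if_pos h, if_neg (by omega)]
  · obtain rfl : i = m := by omega
    simp

theorem Admissible.kappa_nonneg (hα : Admissible x m k α) (i : Set.Icc 1 m) (j : Fin n) :
    0 ≤ kappa m α i j := by
  obtain ⟨i, h1, h2⟩ := i
  simp only [kappa]
  split_ifs with h
  · have := (hα.mono (m - i) (m - i + 1) j j (by omega) (by omega) (by omega) le_rfl).2
    omega
  · exact (hα.mono 1 1 j j le_rfl le_rfl (by omega) le_rfl).1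

theorem Admissible.kappa_mono (hα : Admissible x m k α) {i i' : Set.Icc 1 m} {j j' : Fin n}
    (hi : i ≤ i') (hj : j ≤ j') : kappa m α i j ≤ kappa m α i' j' := by
  obtain ⟨i, h1, h2⟩ := i
  obtain ⟨i', h1', h2'⟩ := i'
  have hi : i ≤ i' := hi
  simp only [kappa]
  split_ifs with h h' h'
  · exact (hα.diff_le (m - i' + 1) (m - i + 1) j' j (by omega) (by omega) (by omega) hj).1
  · have h3 := hα.diff_le (m - i + 1) (m - i + 1) j' j (by omega) le_rfl (by omega) hj
    exact h3.1.trans h3.2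
  · omega
  · exact (hα.mono 1 1 j j' le_rfl le_rfl (by omega) hj).2

theorem monotone_imgKer : Monotone (imgKer x m) := by
  intro i i' h
  have h' : (i : ℕ) ≤ i' := h
  have := map_pow_inf_mono (x := x) (le_refl (⊤ : Submodule K A)) le_top
    (Nat.sub_le_sub_left h' m)
  rwa [top_inf_eq, top_inf_eq] at this

variable [FiniteDimensional K A]

theorem finrank_imgKer (i : Set.Icc 1 m) :
    (finrank K (imgKer x m i) : ℤ) = (finrank K (LinearMap.ker (x ^ (m - (i : ℕ) + 1))) : ℤ)
      - finrank K (LinearMap.ker (x ^ (m - (i : ℕ)))) := by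
  have h := finrank_map_pow_add x (m - i) ⊤
  rw [top_inf_eq, top_inf_eq] at h
  rw [imgKer]
  omega

theorem Admissible.kappa_le (hα : Admissible x m k α) (i : Set.Icc 1 m) (j : Fin n) :
    kappa m α i j ≤ finrank K (imgKer x m i) := by
  rw [finrank_imgKer]
  obtain ⟨i, h1, h2⟩ := i
  simp only [kappa]
  split_ifs with h
  · exact hα.diff_le_ker (m - i + 1) j (by omega) (by omega)
  · obtain rfl : i = m := by omega
    have h3 := hα.first_le_ker h1 j
    have h4 := finrank_inf_ker_pow_zero x ⊤
    rw [top_inf_eq] at h4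
    rw [Nat.sub_self, zero_add, h4]
    simpa using h3

theorem finrank_imgMap_add (V : Fam K A (Fin n)) {i : Set.Icc 1 m} {e : ℕ}
    (h : m - (i : ℕ) = e) (j : Fin n) :
    finrank K (imgMap x m V (i, j))
        + finrank K (V j ⊓ LinearMap.ker (x ^ e) : Submodule K A)
      = finrank K (V j ⊓ LinearMap.ker (x ^ (e + 1)) : Submodule K A) := by
  subst h
  exact finrank_map_pow_add x _ _

/-- The dimensions on the left are successive differences of those on the right, so the sums
telescope from `ker x^0 = 0`. -/
theorem finrank_imgMap_eq_kappa_iff (V : Fam K A (Fin n)) (j : Fin n) :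
    (∀ i, (finrank K (imgMap x m V (i, j)) : ℤ) = kappa m α i j) ↔
      ∀ i, 1 ≤ i → i ≤ m →
        (finrank K (V j ⊓ LinearMap.ker (x ^ i) : Submodule K A) : ℤ) = α i j := by
  have h0 := finrank_inf_ker_pow_zero x (V j)
  constructor
  · intro h i hi him
    induction i, hi using Nat.le_induction with
    | base =>
      have h1 := h ⟨m, him, le_rfl⟩
      have h2 := finrank_imgMap_add (x := x) V (i := ⟨m, him, le_rfl⟩) (Nat.sub_self m) j
      rw [kappa_eq (Nat.sub_self m), if_pos rfl] at h1
      rw [h0, add_zero] at h2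
      rw [← h2, h1, sub_zero]
    | succ e he ih =>
      have h3 : m - (m - e) = e := by omega
      have h4 : 1 ≤ m - e ∧ m - e ≤ m := by omega
      have h1 := h ⟨m - e, h4⟩
      have h2 := finrank_imgMap_add (x := x) V (i := ⟨m - e, h4⟩) h3 j
      rw [kappa_eq h3, if_neg (by omega)] at h1
      rw [← h2, Nat.cast_add, h1, ih (by omega)]
      ring
  · intro h i
    obtain ⟨hi, him⟩ := i.2
    have h1 := h (m - i + 1) (by omega) (by omega)
    have h2 := finrank_imgMap_add (x := x) V (i := i) rfl j
    rw [kappa_eq rfl, ← h1, ← h2]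
    split_ifs with he
    · rw [he, h0]
      simp
    · rw [← h (m - i) (by omega) (by omega)]
      push_cast
      ring

end Numerics

/-! ### Graded subspaces, local constancy and the inverse map. -/

section Isomorphism

open Module

variable {K A : Type*} [Field K] [AddCommGroup A] [Module K A] {x : Module.End K A} {m n : ℕ}
  {π : ℕ → Module.End K A}

namespace IsGrading

/-- By induction on `i`: `x` lowers the degree by one and kills no nonzero element of positive
degree. -/
theorem mem_ker_pow (h : IsGrading x m π) {i : ℕ} {v : A} :
    v ∈ LinearMap.ker (x ^ i) ↔ ∀ r, i ≤ r → π r v = 0 := by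
  induction i generalizing v with
  | zero =>
    simp only [pow_zero, LinearMap.mem_ker, Module.End.one_apply]
    refine ⟨fun hv r _ => by simp [hv], fun hv => ?_⟩
    rw [← h.sum v]
    exact Finset.sum_eq_zero fun r _ => hv r r.zero_le
  | succ i ih =>
    rw [mem_ker_pow_succ, ih]
    have key (r : ℕ) : π r (x v) = 0 ↔ π (r + 1) v = 0 := by
      rw [h.semiconj, h.ker, h.comp, if_neg (Nat.succ_ne_zero r).symm, eq_comm]
    constructor
    · intro hv r hr
      obtain ⟨r, rfl⟩ : ∃ r', r = r' + 1 := ⟨r - 1, by omega⟩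
      exact (key r).1 (hv r (by omega))
    · exact fun hv r hr => (key r).2 (hv (r + 1) (by omega))

theorem apply_mem_ker_pow (h : IsGrading x m π) (e : ℕ) (v : A) :
    π e v ∈ LinearMap.ker (x ^ (e + 1)) :=
  h.mem_ker_pow.2 fun r hr => by rw [h.comp, if_neg (by omega)]

theorem eq_zero_of_pow_apply (h : IsGrading x m π) {e : ℕ} {v : A} (hv : (x ^ e) (π e v) = 0) :
    π e v = 0 := by
  have h1 := h.mem_ker_pow.1 (LinearMap.mem_ker.2 hv) e le_rfl
  rwa [h.comp, if_pos rfl] at h1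

theorem pow_apply_of_mem (h : IsGrading x m π) {e : ℕ} {v : A}
    (hv : v ∈ LinearMap.ker (x ^ (e + 1))) : (x ^ e) v = (x ^ e) (π e v) := by
  rw [← sub_eq_zero, ← map_sub, ← LinearMap.mem_ker, h.mem_ker_pow]
  intro r hr
  rw [map_sub, h.comp]
  split_ifs with hre
  · rw [sub_self]
  · rw [h.mem_ker_pow.1 hv r (by omega), sub_zero]

/-- This links `x`-stability of `V` to the inclusions between consecutive members of the family. -/
theorem pow_succ_apply (h : IsGrading x m π) (e : ℕ) (v : A) :
    (x ^ e) (π e (x v)) = (x ^ (e + 1)) (π (e + 1) v) := by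
  rw [h.semiconj, pow_succ, Module.End.mul_apply]

theorem map_pow_inf (h : IsGrading x m π) {V : Submodule K A} (hV : ∀ r, ∀ v ∈ V, π r v ∈ V)
    (e : ℕ) : Submodule.map (x ^ e) (V ⊓ LinearMap.ker (x ^ (e + 1)))
      = Submodule.map (x ^ e * π e) V := by
  apply le_antisymm
  · rintro _ ⟨v, ⟨hv, hvk⟩, rfl⟩
    exact ⟨v, hv, (h.pow_apply_of_mem hvk).symm⟩
  · rintro _ ⟨v, hv, rfl⟩
    exact ⟨π e v, ⟨hV e v hv, h.apply_mem_ker_pow e v⟩, rfl⟩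

theorem imgKer_eq (h : IsGrading x m π) (i : Set.Icc 1 m) :
    imgKer x m i = LinearMap.range (x ^ (m - (i : ℕ)) * π (m - i)) := by
  have h1 := h.map_pow_inf (V := ⊤) (fun _ _ _ => Submodule.mem_top) (m - i)
  rwa [top_inf_eq, Submodule.map_top] at h1

theorem imgMap_eq (h : IsGrading x m π) {V : Fam K A (Fin n)}
    (hV : ∀ j, ∀ r, ∀ v ∈ V j, π r v ∈ V j) (i : Set.Icc 1 m) (j : Fin n) :
    imgMap x m V (i, j) = Submodule.map (x ^ (m - (i : ℕ)) * π (m - i)) (V j) :=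
  h.map_pow_inf (hV j) _

/-- Sections of the maps `x^e` on the summands of a grading. -/
theorem exists_section (h : IsGrading x m π) :
    ∃ S : ℕ → Module.End K A, (∀ e v, S e ((x ^ e) (π e v)) = π e v) ∧
      ∀ r e v, π r (S e v) = if r = e then S e v else 0 := by
  have h1 (e : ℕ) : ∃ S : Module.End K A, S ∘ₗ (x ^ e * π e) = π e := by
    obtain ⟨S, hS⟩ := LinearMap.exists_extend
      (((LinearMap.ker (x ^ e * π e)).liftQ (π e) fun v hv => h.eq_zero_of_pow_apply hv) ∘ₗ
        (x ^ e * π e).quotKerEquivRange.symm.toLinearMap)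
    refine ⟨S, LinearMap.ext fun v => ?_⟩
    have h2 := LinearMap.congr_fun hS ((x ^ e * π e).rangeRestrict v)
    have h3 : (x ^ e * π e).quotKerEquivRange.symm ((x ^ e * π e).rangeRestrict v)
        = Submodule.Quotient.mk v := by
      rw [LinearEquiv.symm_apply_eq]
      rfl
    simp only [LinearMap.comp_apply, LinearEquiv.coe_coe, h3] at h2
    exact h2
  choose S hS using h1
  -- `S e` was extended arbitrarily off the image of `x^e * π e`; composing with `π e` makes all its
  -- values homogeneous of degree `e`.
  refine ⟨fun e => π e ∘ₗ S e, fun e v => ?_, fun r e v => ?_⟩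
  · have h2 := LinearMap.congr_fun (hS e) v
    simp only [LinearMap.comp_apply, Module.End.mul_apply] at h2 ⊢
    rw [h2, h.comp, if_pos rfl]
  · simp only [LinearMap.comp_apply]
    rw [h.comp]
    by_cases hr : r = e
    · simp [hr]
    · simp [hr]

/-- The dimensions of the intersections with `ker x^i` are locally constant on families of graded
subspaces of fixed dimensions. -/
theorem isLocallyConstant_finrank [FiniteDimensional K A] {ι : Type*} (h : IsGrading x m π)
    {X : Set (Fam K A ι)} (hX : ∀ V ∈ X, ∀ t, ∀ r, ∀ v ∈ V t, π r v ∈ V t) {k : ι → ℕ}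
    (hk : ∀ V ∈ X, ∀ t, finrank K (V t) = k t) (i : ℕ) (t : ι) :
    IsLocallyConstant fun V : X =>
      finrank K (V.1 t ⊓ LinearMap.ker (x ^ i) : Submodule K A) := by
  let p : Module.End K A := ∑ r ∈ Finset.range i, π r
  have hp (v : A) : p v ∈ LinearMap.ker (x ^ i) := by
    refine h.mem_ker_pow.2 fun r hr => ?_
    simp only [p, LinearMap.sum_apply, map_sum, h.comp]
    refine Finset.sum_eq_zero fun r' hr' => if_neg ?_
    have := Finset.mem_range.1 hr'
    omega
  have hp' {v : A} (hv : v ∈ LinearMap.ker (x ^ i)) : p v = v := by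
    have h1 := h.mem_ker_pow.1 hv
    conv_rhs => rw [← h.sum v]
    simp only [p, LinearMap.sum_apply]
    rcases le_total i m with him | him
    · refine Finset.sum_subset (Finset.range_mono him) fun r _ hr => h1 r ?_
      simpa using hr
    · refine (Finset.sum_subset (Finset.range_mono him) fun r _ hr => ?_).symm
      rw [← h.sum v, map_sum]
      refine Finset.sum_eq_zero fun r' hr' => ?_
      rw [h.comp, if_neg]
      simp only [Finset.mem_range] at hr hr'
      omega
  have hker : LinearMap.ker (1 - p) = LinearMap.ker (x ^ i) := by
    ext v
    rw [LinearMap.mem_ker, LinearMap.sub_apply, Module.End.one_apply, sub_eq_zero]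
    exact ⟨fun hv => hv ▸ hp v, fun hv => (hp' hv).symm⟩
  have hmap (V) (hV : V ∈ X) : Submodule.map p (V t) = V t ⊓ LinearMap.ker (x ^ i) := by
    apply le_antisymm
    · rintro _ ⟨v, hv, rfl⟩
      refine ⟨?_, hp v⟩
      simp only [p, LinearMap.sum_apply]
      exact sum_mem fun r _ => hX V hV t r v hv
    · exact fun v hv => ⟨v, hv.1, hp' hv.2⟩
  rw [IsLocallyConstant.iff_isOpen_fiber]
  intro a
  -- The two ranks add up to `k t`, so two lower bounds pin both down. If `a > k t`, the first bound
  -- already fails and the truncated subtraction is harmless.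
  have heq : (fun V : X => finrank K (V.1 t ⊓ LinearMap.ker (x ^ i) : Submodule K A)) ⁻¹' {a}
      = Subtype.val ⁻¹' ({V : Fam K A ι | a ≤ finrank K (Submodule.map p (V t))} ∩
        {V : Fam K A ι | k t - a ≤ finrank K (Submodule.map (1 - p) (V t))}) := by
    ext ⟨V, hV⟩
    have h1 := finrank_map_add_finrank_inf_ker (1 - p) (V t)
    rw [hker, hk V hV] at h1
    change finrank K (V t ⊓ LinearMap.ker (x ^ i) : Submodule K A) = a ↔
      a ≤ finrank K (Submodule.map p (V t)) ∧ k t - a ≤ finrank K (Submodule.map (1 - p) (V t))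
    rw [hmap V hV]
    omega
  rw [heq]
  exact ((isOpen_le_finrank_map p t a).inter
    (isOpen_le_finrank_map (1 - p) t (k t - a))).preimage continuous_subtype_val

theorem isClopen_relPosition [FiniteDimensional K A] (h : IsGrading x m π) {k : Fin n → ℕ}
    {X : Set (Fam K A (Fin n))} (hX : ∀ V ∈ X, ∀ t, ∀ r, ∀ v ∈ V t, π r v ∈ V t)
    (hk : X ⊆ partialFlags K A k) (α : ℕ → Fin n → ℤ) :
    IsClopen {V : X | V.1 ∈ relPosition x m k α} := by
  have heq : {V : X | V.1 ∈ relPosition x m k α}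
      = ⋂ i ∈ Finset.Icc 1 m, ⋂ j : Fin n,
        (fun V : X => finrank K (V.1 j ⊓ LinearMap.ker (x ^ i) : Submodule K A)) ⁻¹'
          {a | (a : ℤ) = α i j} := by
    ext ⟨V, hV⟩
    simp only [relPosition, Set.mem_ofPred_eq, Set.mem_iInter, Finset.mem_Icc, Set.mem_preimage,
      hk hV, true_and, and_imp]
  rw [heq]
  refine isClopen_biInter_finset fun i _ => isClopen_iInter_of_finite fun j => ?_
  have h1 := h.isLocallyConstant_finrank hX (fun V hV => (hk hV).1) i j
  exact ⟨⟨h1 {a | (a : ℤ) = α i j}ᶜ⟩, h1 _⟩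

end IsGrading

theorem iSup_map_ite_eq {ι : Type*} [DecidableEq ι] (f : Module.End K A) (V : Fam K A ι) (j : ι) :
    ⨆ t, Submodule.map (if t = j then f else 0) (V t) = Submodule.map f (V j) := by
  apply le_antisymm
  · refine iSup_le fun t => ?_
    split_ifs with h
    · rw [h]
    · simp
  · exact le_iSup_of_le j (by simp)

theorem iSup_map_ite_snd_eq {ι κ : Type*} [DecidableEq κ] (f : ι → Module.End K A)
    (W : Fam K A (ι × κ)) (j : κ) :
    ⨆ t : ι × κ, Submodule.map (if t.2 = j then f t.1 else 0) (W t)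
      = ⨆ i, Submodule.map (f i) (W (i, j)) := by
  apply le_antisymm
  · refine iSup_le fun ⟨i, j'⟩ => ?_
    split_ifs with h
    · obtain rfl : j' = j := h
      exact le_iSup_of_le i le_rfl
    · simp
  · exact iSup_le fun i => le_iSup_of_le (i, j) (by simp)

theorem IsGrading.isIsomorphismOn [FiniteDimensional K A] (h : IsGrading x m π) {k : Fin n → ℕ}
    {s : LinearMap.GeneralLinearGroup K A}
    (hs : ∀ V : Submodule K A, Submodule.map (s : Module.End K A) V = V ↔
      ∀ r, ∀ v ∈ V, π r v ∈ V) {α : ℕ → Fin n → ℤ} (hα : Admissible x m k α)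
    (hkA : ∀ j, k j ≤ finrank K A) :
    IsIsomorphismOn (fixedStableFlags x s k ∩ relPosition x m k α)
      (doubleFlags (imgKer x m) (kappa m α)) (imgMap x m) := by
  classical
  have hst {V} (hV : V ∈ fixedStableFlags x s k ∩ relPosition x m k α) :
      ∀ j, ∀ r, ∀ v ∈ V j, π r v ∈ V j := fun j => (hs _).1 (hV.1.2.2 j)
  obtain ⟨S, hS, hπS⟩ := h.exists_section
  let G (W : Fam K A (Set.Icc 1 m × Fin n)) : Fam K A (Fin n) :=
    fun j => ⨆ i : Set.Icc 1 m, Submodule.map (S (m - i)) (W (i, j))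
  have hmem {W : Fam K A (Set.Icc 1 m × Fin n)} {i : Set.Icc 1 m} {j : Fin n} {e : ℕ} {w : A}
      (he : m - (i : ℕ) = e) (hw : w ∈ W (i, j)) : S e w ∈ G W j :=
    Submodule.mem_iSup_of_mem i (he ▸ ⟨w, hw, rfl⟩)
  have hxm : LinearMap.ker (x ^ m) = ⊤ := by
    refine eq_top_iff.2 fun v _ => h.mem_ker_pow.2 fun r hr => ?_
    rw [← h.sum v, map_sum]
    refine Finset.sum_eq_zero fun r' hr' => ?_
    rw [h.comp, if_neg]
    have := Finset.mem_range.1 hr'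
    omega
  have hGst (W j) : ∀ r, ∀ v ∈ G W j, π r v ∈ G W j := by
    intro r
    change G W j ≤ (G W j).comap (π r)
    refine iSup_le fun i => ?_
    rintro _ ⟨w, hw, rfl⟩
    rw [Submodule.mem_comap, hπS]
    split_ifs
    · exact hmem rfl hw
    · exact zero_mem _
  have hFX : Set.MapsTo (imgMap x m) (fixedStableFlags x s k ∩ relPosition x m k α)
      (doubleFlags (imgKer x m) (kappa m α)) := by
    intro V hV
    refine ⟨fun i j => ⟨Submodule.map_mono inf_le_right,
      (finrank_imgMap_eq_kappa_iff V j).2 (fun i h1 h2 => hV.2.2 i h1 h2 j) i⟩, ?_⟩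
    intro i i' j j' hi hj
    have hi' : (i : ℕ) ≤ i' := hi
    exact map_pow_inf_mono (hV.1.1.2 j j' hj) (hV.1.2.1 j') (Nat.sub_le_sub_left hi' m)
  have hFG (W) (hW : W ∈ doubleFlags (imgKer x m) (kappa m α)) : imgMap x m (G W) = W := by
    funext ⟨i, j⟩
    have hT (w : A) (hw : w ∈ W (i, j)) : (x ^ (m - (i : ℕ))) (S (m - i) w) = w := by
      obtain ⟨v, rfl⟩ := h.imgKer_eq i ▸ (hW.1 i j).1 hw
      rw [Module.End.mul_apply, hS]
    rw [h.imgMap_eq (hGst W) i j]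
    apply le_antisymm
    · rw [Submodule.map_le_iff_le_comap]
      refine iSup_le fun i' => ?_
      rintro _ ⟨w, hw, rfl⟩
      rw [Submodule.mem_comap, Module.End.mul_apply, hπS]
      split_ifs with he
      · obtain rfl : i = i' := by
          have h1 := i.2
          have h2 := i'.2
          simp only [Set.mem_Icc] at h1 h2
          exact Subtype.ext (by omega)
        rw [hT w hw]
        exact hw
      · rw [map_zero]
        exact zero_mem _
    · intro w hw
      refine ⟨S (m - i) w, hmem rfl hw, ?_⟩
      rw [Module.End.mul_apply, hπS, if_pos rfl, hT w hw]
  have hGX : Set.MapsTo G (doubleFlags (imgKer x m) (kappa m α))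
      (fixedStableFlags x s k ∩ relPosition x m k α) := by
    intro W hW
    have hrel (j) := (finrank_imgMap_eq_kappa_iff (x := x) (m := m) (α := α) (G W) j).1 fun i => by
      rw [hFG W hW]
      exact (hW.1 i j).2
    have hflag : G W ∈ partialFlags K A k := by
      refine ⟨fun j => ?_, fun j j' hj => iSup_mono fun i =>
        Submodule.map_mono (hW.2 i i j j' le_rfl hj)⟩
      -- For `m = 0` no entry of `α` is constrained, but then `A = 0` and `hkA` gives `k j = 0`.
      rcases Nat.eq_zero_or_pos m with hm | hm
      · rw [hm, pow_zero, Module.End.one_eq_id, LinearMap.ker_id] at hxm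
        have h0 : finrank K A = 0 := by rw [← finrank_top K A, ← hxm, finrank_bot]
        have h1 := Submodule.finrank_le (G W j)
        have h2 := hkA j
        omega
      · have h1 := hrel j m hm le_rfl
        rw [hxm, inf_top_eq, hα.top hm] at h1
        exact_mod_cast h1
    refine ⟨⟨hflag, fun j => ?_, fun j => (hs _).2 (hGst W j)⟩,
      hflag, fun i h1 h2 j => hrel j i h1 h2⟩
    rw [Submodule.map_le_iff_le_comap]
    refine iSup_le fun i => ?_
    rintro _ ⟨w, hw, rfl⟩
    rw [Submodule.mem_comap]
    obtain ⟨v, hv⟩ := h.imgKer_eq i ▸ (hW.1 i j).1 hw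
    rw [Module.End.mul_apply] at hv
    obtain ⟨hi1, hi2⟩ := i.2
    cases he : m - (i : ℕ) with
    | zero =>
      have h1 : x (S 0 w) = 0 := by rw [h.ker, hπS, if_pos rfl]
      rw [h1]
      exact zero_mem _
    | succ e =>
      rw [he] at hv
      -- Thus `x` carries the lift of `w` in degree `e + 1` to its lift in degree `e`, and `w` also
      -- lies in the next member `W (i + 1, j)`.
      have h1 : x (S (e + 1) w) = S e w := by
        rw [← hv, hS, ← h.pow_succ_apply, hS, h.semiconj]
      rw [h1]
      have h2 : 1 ≤ (i : ℕ) + 1 ∧ (i : ℕ) + 1 ≤ m := by omega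
      exact hmem (i := ⟨i + 1, h2⟩) (by simp only []; omega)
        (hW.2 i ⟨i + 1, h2⟩ j j (Nat.le_succ _) le_rfl hw)
  have hGF (V) (hV : V ∈ fixedStableFlags x s k ∩ relPosition x m k α) :
      G (imgMap x m V) = V := by
    funext j
    apply le_antisymm
    · refine iSup_le fun i => ?_
      rw [h.imgMap_eq (hst hV)]
      rintro _ ⟨_, ⟨v, hv, rfl⟩, rfl⟩
      rw [Module.End.mul_apply, hS]
      exact hst hV j _ v hv
    · intro v hv
      rw [← h.sum v]
      refine sum_mem fun r hr => ?_
      rw [Finset.mem_range] at hr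
      have h1 : 1 ≤ m - r ∧ m - r ≤ m := by omega
      have h2 : m - (m - r) = r := by omega
      rw [← hS]
      refine hmem (i := ⟨m - r, h1⟩) h2 ?_
      rw [h.imgMap_eq (hst hV)]
      simp only [h2]
      exact ⟨v, hv, rfl⟩
  refine ⟨isMorphismOn_of_linear hFX
    (fun t j => if j = t.2 then x ^ (m - (t.1 : ℕ)) * π (m - t.1) else 0) ?_
    (fun t => (kappa m α t.1 t.2).toNat) ?_,
    G, isMorphismOn_of_linear hGX (fun j t => if t.2 = j then S (m - t.1) else 0) ?_ k ?_,
    fun V hV => hGF V hV, fun W hW => hFG W hW⟩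
  · rintro V hV ⟨i, j⟩
    exact (h.imgMap_eq (hst hV) i j).trans (iSup_map_ite_eq _ V j).symm
  · rintro V hV ⟨i, j⟩
    exact congrArg Int.toNat ((hFX hV).1 i j).2
  · exact fun W hW j => (iSup_map_ite_snd_eq (fun i : Set.Icc 1 m => S (m - i)) W j).symm
  · exact fun W hW j => (hGX hW).2.1.1 j

end Isomorphism

end NilFlag

theorem proposition3p2 {K A : Type*} [Field K] [IsAlgClosed K] [CharZero K]
    [AddCommGroup A] [Module K A] [FiniteDimensional K A]
    (x : Module.End K A) (hx : IsNilpotent x) (m : ℕ) (hm : m = nilpotencyClass x)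
    (s : LinearMap.GeneralLinearGroup K A) (hs : NilFlag.IsAdapted x s)
    {n : ℕ} (k : Fin n → ℕ) (hk : Monotone k) (hkA : ∀ j, k j ≤ Module.finrank K A)
    (α : ℕ → Fin n → ℤ) (hα : NilFlag.Admissible x m k α) :
    -- the `A_i` form a partial flag with the stated dimension vector
    (Monotone (NilFlag.imgKer x m) ∧
      ∀ i : Set.Icc 1 m, (Module.finrank K (NilFlag.imgKer x m i) : ℤ) =
        (Module.finrank K (LinearMap.ker (x ^ (m - (i : ℕ) + 1))) : ℤ)
          - Module.finrank K (LinearMap.ker (x ^ (m - (i : ℕ))))) ∧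
    -- `κ` is a matrix for which the variety of doubly indexed flags is defined
    ((∀ i j, 0 ≤ NilFlag.kappa m α i j ∧
        NilFlag.kappa m α i j ≤ Module.finrank K (NilFlag.imgKer x m i)) ∧
      ∀ i i' j j', i ≤ i' → j ≤ j' → NilFlag.kappa m α i j ≤ NilFlag.kappa m α i' j') ∧
    -- (a)
    IsClopen {V : NilFlag.fixedStableFlags x s k | V.1 ∈ NilFlag.relPosition x m k α} ∧
    -- (b)
    NilFlag.IsIsomorphismOn
      (NilFlag.fixedStableFlags x s k ∩ NilFlag.relPosition x m k α)
      (NilFlag.doubleFlags (NilFlag.imgKer x m) (NilFlag.kappa m α))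
      (NilFlag.imgMap x m) := by
  obtain rfl := hm
  obtain ⟨π, hπ, hst⟩ := NilFlag.exists_isGrading hs hx
  exact ⟨⟨NilFlag.monotone_imgKer, NilFlag.finrank_imgKer⟩,
    ⟨fun i j => ⟨hα.kappa_nonneg i j, hα.kappa_le i j⟩, fun _ _ _ _ => hα.kappa_mono⟩,
    hπ.isClopen_relPosition (fun V hV j => (hst _).1 (hV.2.2 j)) (fun V hV => hV.1) α,
    hπ.isIsomorphismOn hst hα hkA⟩
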